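/- Let $D\in\mathbb R$ and $A>0$. For each $j\in\mathbb N$ let $M_j$ be the three-sphere with a smooth rotationally symmetric Riemannian metric $$g_j=ds^2+f_j(s)^2g_{\mathbb S^2},\qquad 0\le s\le D_j ,$$ where $D_j>0$, $f_j$ is smooth on $[0,D_j]$, $f_j>0$ on $(0,D_j)$, $f_j(0)=f_j(D_j)=0$, $f_j'(0)=1$ and $f_j'(D_j)=-1$. Suppose that for all $j$ $$\operatorname{Diam}(M_j)\le D,\qquad \operatorname{Scalar}_{g_j}\ge 0,\qquad \operatorname{MinA}(M_j)\ge A,$$ where $\operatorname{MinA}(M_j)$ is the infimum of the areas of the closed embedded minimal surfaces in $M_j$. Extend $f_j$ by $0$ outside $[0,D_j]$, and suppose that a subsequence of $(f_j)$ converges uniformly on $[0,D]$ to a function $f_\infty$. Put $$a_\infty=\sup\{s\in[0,D]: f_\infty=0\text{ on }[0,s]\},\qquad b_\infty=\inf\{s\in[0,D]: f_\infty=0\text{ on }[s,D]\},$$ and let $M_\infty=[a_\infty,b_\infty]\times\mathbb S^2$ with the continuous metric tensor $g_\infty=ds^2+f_\infty(s)^2g_{\mathbb S^2}$ and the induced length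 distance $d_\infty$ (points at distance $0$ being identified, so that the spheres where $f_\infty=0$ collapse to points). Then for almost every $p\in M_\infty$, with respect to the Riemannian volume $f_\infty(s)^2\,ds\,d\mathrm{vol}_{\mathbb S^2}$, the tangent cone of $M_\infty$ at $p$ is Euclidean three-space: for every sequence $r_n>0$ with $r_n\to0$, the pointed metric spaces $(M_\infty, r_n^{-1}d_\infty,p)$ converge in the pointed Gromov–Hausdorff sense to $(\mathbb E^3,0)$. -/

import Mathlib

open Set Filter Topology MeasureTheory
open scoped ENNReal NNReal ContDiff

/-- Euclidean `3`-space. -/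
abbrev E3 : Type := EuclideanSpace ℝ (Fin 3)

/-- The unit sphere of Euclidean `3`-space. -/
abbrev S2 : Type := Metric.sphere (0 : E3) 1

/-! ### Warped products `[a, b] × S²` with metric tensor `ds² + f(s)² g_{S²}` as metric spaces -/

/-- A Lipschitz curve `t ↦ (s t, θ t)`, `0 ≤ t ≤ T`, in `[a, b] × S²`. The sphere component is
regarded as a curve in Euclidean `3`-space with values in the unit sphere, so that the length of
its velocity for the round metric is the Euclidean norm of its derivative. -/
structure WarpedCurve (a b : ℝ) where
  T : ℝ
  s : ℝ → ℝ
  θ : ℝ → E3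
  T_nonneg : 0 ≤ T
  s_lipschitz : ∃ K : ℝ≥0, LipschitzOnWith K s (Icc 0 T)
  θ_lipschitz : ∃ K : ℝ≥0, LipschitzOnWith K θ (Icc 0 T)
  s_mem : ∀ t ∈ Icc 0 T, s t ∈ Icc a b
  θ_mem : ∀ t ∈ Icc 0 T, θ t ∈ Metric.sphere (0 : E3) 1

/-- The length of a curve for the metric tensor `ds² + f(s)² g_{S²}`. -/
noncomputable def WarpedCurve.length {a b : ℝ} (f : ℝ → ℝ) (c : WarpedCurve a b) : ℝ≥0∞ :=
  ∫⁻ t in Icc 0 c.T,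
    ENNReal.ofReal (Real.sqrt ((deriv c.s t) ^ 2 + (f (c.s t)) ^ 2 * ‖deriv c.θ t‖ ^ 2))

/-- Coordinates `(s, θ) ∈ [a, b] × S²` for the warped product with warping function `f`. -/
structure WarpedCoord (a b : ℝ) (f : ℝ → ℝ) where
  s : ℝ
  s_mem : s ∈ Icc a b
  θ : S2

/-- The curve `c` runs from `p` to `q`. -/
def WarpedCurve.Joins {a b : ℝ} {f : ℝ → ℝ} (c : WarpedCurve a b) (p q : WarpedCoord a b f) :
    Prop :=
  c.s 0 = p.s ∧ c.θ 0 = p.θ ∧ c.s c.T = q.s ∧ c.θ c.T = q.θ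

/-- The Riemannian (pseudo-)distance: the infimum of the lengths of the curves from `p` to `q`. -/
noncomputable def warpedDist {a b : ℝ} {f : ℝ → ℝ} (p q : WarpedCoord a b f) : ℝ≥0∞ :=
  ⨅ (c : WarpedCurve a b) (_ : c.Joins p q), c.length f

theorem warpedDist_self {a b : ℝ} {f : ℝ → ℝ} (p : WarpedCoord a b f) : warpedDist p p = 0 := by
  refine le_antisymm ?_ zero_le
  let c : WarpedCurve a b :=
    { T := 0
      s := fun _ => p.s
      θ := fun _ => p.θ
      T_nonneg := le_rfl
      s_lipschitz := ⟨0, (LipschitzWith.const _).lipschitzOnWith⟩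
      θ_lipschitz := ⟨0, (LipschitzWith.const _).lipschitzOnWith⟩
      s_mem := fun _ _ => p.s_mem
      θ_mem := fun _ _ => p.θ.2 }
  have hc : c.Joins p p := ⟨rfl, rfl, rfl, rfl⟩
  refine (iInf₂_le c hc).trans ?_
  simp [WarpedCurve.length, c]

theorem lipschitzOn_reverse {X : Type*} [PseudoMetricSpace X] {u : ℝ → X} {T : ℝ} {K : ℝ≥0}
    (hu : LipschitzOnWith K u (Icc 0 T)) : LipschitzOnWith K (fun t => u (T - t)) (Icc 0 T) := by
  refine LipschitzOnWith.of_dist_le_mul fun x hx y hy => ?_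
  have h := hu.dist_le_mul (T - x) ⟨by linarith [hx.2], by linarith [hx.1]⟩ (T - y)
    ⟨by linarith [hy.2], by linarith [hy.1]⟩
  rwa [dist_sub_left] at h

theorem lipschitzOn_concat {X : Type*} [PseudoMetricSpace X] {u v : ℝ → X} {T₁ T₂ : ℝ}
    {K₁ K₂ : ℝ≥0} (h1 : 0 ≤ T₁) (h2 : 0 ≤ T₂) (hu : LipschitzOnWith K₁ u (Icc 0 T₁))
    (hv : LipschitzOnWith K₂ v (Icc 0 T₂)) (huv : u T₁ = v 0) :
    LipschitzOnWith (K₁ + K₂) (fun t => if t ≤ T₁ then u t else v (t - T₁))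
      (Icc 0 (T₁ + T₂)) := by
  have key : ∀ x ∈ Icc 0 (T₁ + T₂), ∀ y ∈ Icc 0 (T₁ + T₂), x ≤ y →
      dist (if x ≤ T₁ then u x else v (x - T₁)) (if y ≤ T₁ then u y else v (y - T₁))
        ≤ (K₁ + K₂ : ℝ≥0) * dist x y := by
    intro x hx y hy hxy
    have hK1 : (0 : ℝ) ≤ K₁ := K₁.2
    have hK2 : (0 : ℝ) ≤ K₂ := K₂.2
    have hd : dist x y = y - x := by rw [dist_comm, Real.dist_eq, abs_of_nonneg (by linarith)]
    rw [hd, NNReal.coe_add]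
    by_cases hy1 : y ≤ T₁
    · have hx1 : x ≤ T₁ := hxy.trans hy1
      rw [if_pos hx1, if_pos hy1]
      have h := hu.dist_le_mul x ⟨hx.1, hx1⟩ y ⟨hy.1, hy1⟩
      rw [hd] at h
      nlinarith
    · rw [if_neg hy1]
      push Not at hy1
      by_cases hx1 : x ≤ T₁
      · rw [if_pos hx1]
        have ha := hu.dist_le_mul x ⟨hx.1, hx1⟩ T₁ ⟨h1, le_rfl⟩
        have hb := hv.dist_le_mul 0 ⟨le_rfl, h2⟩ (y - T₁) ⟨by linarith, by linarith [hy.2]⟩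
        rw [dist_comm x, Real.dist_eq, abs_of_nonneg (by linarith)] at ha
        rw [dist_comm (0 : ℝ), Real.dist_eq, abs_of_nonneg (by linarith)] at hb
        have ht := dist_triangle (u x) (u T₁) (v (y - T₁))
        rw [huv] at ht ha
        nlinarith
      · rw [if_neg hx1]
        push Not at hx1
        have h := hv.dist_le_mul (x - T₁) ⟨by linarith, by linarith [hx.2]⟩ (y - T₁)
          ⟨by linarith, by linarith [hy.2]⟩
        rw [dist_sub_right, hd] at h
        nlinarith
  refine LipschitzOnWith.of_dist_le_mul fun x hx y hy => ?_
  rcases le_total x y with h | h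
  · exact key x hx y hy h
  · rw [dist_comm, dist_comm x y]
    exact key y hy x hx h

theorem warpedDist_comm_le {a b : ℝ} {f : ℝ → ℝ} (p q : WarpedCoord a b f) :
    warpedDist q p ≤ warpedDist p q := by
  refine le_iInf₂ fun c hc => ?_
  have hmem : ∀ t ∈ Icc 0 c.T, c.T - t ∈ Icc 0 c.T := fun t ht =>
    ⟨by linarith [ht.2], by linarith [ht.1]⟩
  let c' : WarpedCurve a b :=
    { T := c.T
      s := fun t => c.s (c.T - t)
      θ := fun t => c.θ (c.T - t)
      T_nonneg := c.T_nonneg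
      s_lipschitz := c.s_lipschitz.imp fun _ h => lipschitzOn_reverse h
      θ_lipschitz := c.θ_lipschitz.imp fun _ h => lipschitzOn_reverse h
      s_mem := fun t ht => c.s_mem _ (hmem t ht)
      θ_mem := fun t ht => c.θ_mem _ (hmem t ht) }
  have hc' : c'.Joins q p := by
    obtain ⟨h1, h2, h3, h4⟩ := hc
    refine ⟨?_, ?_, ?_, ?_⟩ <;> simp [c', h1, h2, h3, h4]
  refine (iInf₂_le c' hc').trans (le_of_eq ?_)
  have hpre : (fun t => c.T - t) ⁻¹' Icc 0 c.T = Icc 0 c.T := by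
    simp
  have hmp := (Measure.measurePreserving_sub_left (volume : Measure ℝ) c.T).setLIntegral_comp_preimage_emb
    (MeasurableEquiv.subLeft c.T).measurableEmbedding
    (fun t => ENNReal.ofReal
      (Real.sqrt ((deriv c.s t) ^ 2 + (f (c.s t)) ^ 2 * ‖deriv c.θ t‖ ^ 2))) (Icc 0 c.T)
  rw [hpre] at hmp
  rw [WarpedCurve.length, WarpedCurve.length, ← hmp]
  simp only [c', deriv_comp_const_sub, neg_sq, norm_neg]

theorem warpedDist_triangle {a b : ℝ} {f : ℝ → ℝ} (p q r : WarpedCoord a b f) :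
    warpedDist p r ≤ warpedDist p q + warpedDist q r := by
  conv_rhs => unfold warpedDist
  simp only [ENNReal.iInf_add, ENNReal.add_iInf]
  refine le_iInf fun e => le_iInf fun he => le_iInf fun c => le_iInf fun hc => ?_
  obtain ⟨hc1, hc2, hc3, hc4⟩ := hc
  obtain ⟨he1, he2, he3, he4⟩ := he
  have hcT := c.T_nonneg
  have heT := e.T_nonneg
  have hs : c.s c.T = e.s 0 := hc3.trans he1.symm
  have hθ : c.θ c.T = e.θ 0 := hc4.trans he2.symm
  let k : WarpedCurve a b :=
    { T := c.T + e.T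
      s := fun t => if t ≤ c.T then c.s t else e.s (t - c.T)
      θ := fun t => if t ≤ c.T then c.θ t else e.θ (t - c.T)
      T_nonneg := add_nonneg hcT heT
      s_lipschitz := by
        obtain ⟨K, hK⟩ := c.s_lipschitz
        obtain ⟨K', hK'⟩ := e.s_lipschitz
        exact ⟨K + K', lipschitzOn_concat hcT heT hK hK' hs⟩
      θ_lipschitz := by
        obtain ⟨K, hK⟩ := c.θ_lipschitz
        obtain ⟨K', hK'⟩ := e.θ_lipschitz
        exact ⟨K + K', lipschitzOn_concat hcT heT hK hK' hθ⟩
      s_mem := by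
        intro t ht
        split_ifs with h
        · exact c.s_mem t ⟨ht.1, h⟩
        · exact e.s_mem _ ⟨by linarith, by linarith [ht.2]⟩
      θ_mem := by
        intro t ht
        split_ifs with h
        · exact c.θ_mem t ⟨ht.1, h⟩
        · exact e.θ_mem _ ⟨by linarith, by linarith [ht.2]⟩ }
  have hk : k.Joins p r := by
    refine ⟨?_, ?_, ?_, ?_⟩
    · simp [k, hcT, hc1]
    · simp [k, hcT, hc2]
    · by_cases h : e.T ≤ 0
      · have h0 : e.T = 0 := le_antisymm h heT
        rw [h0] at he3
        simp [k, h0, hs, he3]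
      · simp [k, h, he3]
    · by_cases h : e.T ≤ 0
      · have h0 : e.T = 0 := le_antisymm h heT
        rw [h0] at he4
        simp [k, h0, hθ, he4]
      · simp [k, h, he4]
  refine (iInf₂_le k hk).trans ?_
  have hsub : Icc 0 k.T ⊆ Iio c.T ∩ Icc 0 c.T ∪ ({c.T} ∪ Ioc c.T (c.T + e.T)) := by
    intro t ht
    have ht2 : t ≤ c.T + e.T := ht.2
    rcases lt_trichotomy t c.T with h | h | h
    · exact Or.inl ⟨h, ht.1, h.le⟩
    · exact Or.inr (Or.inl h)
    · exact Or.inr (Or.inr ⟨h, ht2⟩)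
  let F : ℝ → ℝ≥0∞ := fun t => ENNReal.ofReal
      (Real.sqrt ((deriv k.s t) ^ 2 + (f (k.s t)) ^ 2 * ‖deriv k.θ t‖ ^ 2))
  have hA : ∫⁻ t in Iio c.T ∩ Icc 0 c.T, F t ≤ c.length f := by
    have heq : ∫⁻ t in Iio c.T ∩ Icc 0 c.T, F t = ∫⁻ t in Iio c.T ∩ Icc 0 c.T,
        ENNReal.ofReal (Real.sqrt ((deriv c.s t) ^ 2 + (f (c.s t)) ^ 2 * ‖deriv c.θ t‖ ^ 2)) := by
      refine setLIntegral_congr_fun (measurableSet_Iio.inter measurableSet_Icc) ?_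
      intro t ht
      have hev : ∀ᶠ x in 𝓝 t, x ≤ c.T := (eventually_lt_nhds ht.1).mono fun _ h => h.le
      have e1 : deriv k.s t = deriv c.s t :=
        EventuallyEq.deriv_eq (hev.mono fun x hx => if_pos hx)
      have e2 : deriv k.θ t = deriv c.θ t :=
        EventuallyEq.deriv_eq (hev.mono fun x hx => if_pos hx)
      have e3 : k.s t = c.s t := if_pos (le_of_lt ht.1)
      simp only [F, e1, e2, e3]
    rw [heq]
    exact lintegral_mono_set inter_subset_right
  have hB : ∫⁻ t in Ioc c.T (c.T + e.T), F t ≤ e.length f := by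
    have heq : ∫⁻ t in Ioc c.T (c.T + e.T), F t = ∫⁻ t in (fun t => t - c.T) ⁻¹' Ioc 0 e.T,
        (fun t => ENNReal.ofReal (Real.sqrt ((deriv e.s t) ^ 2 +
          (f (e.s t)) ^ 2 * ‖deriv e.θ t‖ ^ 2))) (t - c.T) := by
      have hpre : (fun t => t - c.T) ⁻¹' Ioc 0 e.T = Ioc c.T (c.T + e.T) := by
        simp [add_comm]
      rw [hpre]
      refine setLIntegral_congr_fun measurableSet_Ioc ?_
      intro t ht
      have hev : ∀ᶠ x in 𝓝 t, ¬ x ≤ c.T := (eventually_gt_nhds ht.1).mono fun _ h => not_le.2 h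
      have e1 : deriv k.s t = deriv e.s (t - c.T) := by
        rw [← deriv_comp_sub_const]
        exact EventuallyEq.deriv_eq (hev.mono fun x hx => if_neg hx)
      have e2 : deriv k.θ t = deriv e.θ (t - c.T) := by
        rw [← deriv_comp_sub_const]
        exact EventuallyEq.deriv_eq (hev.mono fun x hx => if_neg hx)
      have e3 : k.s t = e.s (t - c.T) := if_neg (not_le.2 ht.1)
      simp only [F, e1, e2, e3]
    have hmp := (measurePreserving_sub_right (volume : Measure ℝ)
      c.T).setLIntegral_comp_preimage_emb (MeasurableEquiv.subRight c.T).measurableEmbedding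
      (fun t => ENNReal.ofReal (Real.sqrt ((deriv e.s t) ^ 2 +
          (f (e.s t)) ^ 2 * ‖deriv e.θ t‖ ^ 2))) (Ioc 0 e.T)
    rw [heq]
    refine hmp.le.trans ?_
    exact lintegral_mono_set Ioc_subset_Icc_self
  have h0 : ∫⁻ t in {c.T}, F t = 0 := by simp
  calc k.length f = ∫⁻ t in Icc 0 k.T, F t := rfl
    _ ≤ ∫⁻ t in Iio c.T ∩ Icc 0 c.T ∪ ({c.T} ∪ Ioc c.T (c.T + e.T)), F t := lintegral_mono_set hsub
    _ ≤ (∫⁻ t in Iio c.T ∩ Icc 0 c.T, F t) + (∫⁻ t in {c.T} ∪ Ioc c.T (c.T + e.T), F t) :=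
        lintegral_union_le _ _ _
    _ ≤ (∫⁻ t in Iio c.T ∩ Icc 0 c.T, F t) +
          ((∫⁻ t in {c.T}, F t) + (∫⁻ t in Ioc c.T (c.T + e.T), F t)) :=
        add_le_add le_rfl (lintegral_union_le _ _ _)
    _ ≤ c.length f + e.length f := by
        rw [h0, zero_add]
        exact add_le_add hA hB

noncomputable instance (a b : ℝ) (f : ℝ → ℝ) : PseudoEMetricSpace (WarpedCoord a b f) where
  edist := warpedDist
  edist_self := warpedDist_self
  edist_comm p q := le_antisymm (warpedDist_comm_le q p) (warpedDist_comm_le p q)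
  edist_triangle := warpedDist_triangle

/-- The warped product `[a, b] × S²` with metric tensor `ds² + f(s)² g_{S²}` as a metric space
(with the distance in `[0, ∞]`). Coordinates at distance zero are identified; this collapses
`{s} × S²` to a point (a pole) when `f s = 0`. -/
abbrev WarpedSpace (a b : ℝ) (f : ℝ → ℝ) : Type := SeparationQuotient (WarpedCoord a b f)

noncomputable instance (a b : ℝ) (f : ℝ → ℝ) : MeasurableSpace (WarpedSpace a b f) := borel _

instance (a b : ℝ) (f : ℝ → ℝ) : BorelSpace (WarpedSpace a b f) := ⟨rfl⟩

/-- The point of the warped product with coordinates `(s, θ)`. -/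
noncomputable def warpedPoint {a b : ℝ} (f : ℝ → ℝ) {s : ℝ} (hs : s ∈ Icc a b) (θ : S2) : WarpedSpace a b f :=
  SeparationQuotient.mk ⟨s, hs, θ⟩

/-- The Riemannian volume measure `f(s)² ds dvol_{S²}` in the coordinates `(s, θ) ∈ [a, b] × S²`. -/
noncomputable def warpedVolume (a b : ℝ) (f : ℝ → ℝ) : Measure (ℝ × S2) :=
  ((volume.restrict (Icc a b)).withDensity fun s => ENNReal.ofReal (f s ^ 2)).prod
    (volume : Measure E3).toSphere

/-! ### Tangent cones -/

/-- Pointed Gromov-Hausdorff convergence of the rescaled spaces `(X, c n • d, p)` to `(Y, y)`: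
for all `R, ε > 0` and all large `n` there is a map `φ` with `φ p = y` whose distortion on the ball
of radius `R` about `p` is smaller than `ε` and for which the `ε`-neighbourhood of the image of
that ball contains the ball of radius `R - ε` about `y`. -/
def PointedGHConverges {X Y : Type*} [PseudoEMetricSpace X] [MetricSpace Y] (c : ℕ → ℝ) (p : X)
    (y : Y) : Prop :=
  ∀ R > 0, ∀ ε > 0, ∀ᶠ n in atTop, ∃ φ : X → Y, φ p = y ∧
    (∀ x x' : X, ENNReal.ofReal (c n) * edist p x < ENNReal.ofReal R →
      ENNReal.ofReal (c n) * edist p x' < ENNReal.ofReal R →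
      |dist (φ x) (φ x') - c n * (edist x x').toReal| < ε) ∧
    (∀ z : Y, dist y z < R - ε →
      ∃ x : X, ENNReal.ofReal (c n) * edist p x < ENNReal.ofReal R ∧ dist (φ x) z < ε)

/-- The tangent cones of `X` at `p` are `(Y, y)`: for every sequence of radii `r n > 0` tending to
`0`, the rescaled spaces `(X, d / r n, p)` converge to `(Y, y)` in the pointed Gromov-Hausdorff
sense. -/
def TangentConesAre {X Y : Type*} [PseudoEMetricSpace X] [MetricSpace Y] (p : X) (y : Y) : Prop :=
  ∀ r : ℕ → ℝ, (∀ n, 0 < r n) → Tendsto r atTop (𝓝 0) →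
    PointedGHConverges (fun n => (r n)⁻¹) p y

/-! ### Riemannian metrics in a coordinate chart of dimension three -/

/-- The `i`-th partial derivative. -/
noncomputable def pd (i : Fin 3) (u : E3 → ℝ) (x : E3) : ℝ :=
  lineDeriv ℝ u x (EuclideanSpace.single i 1)

/-- The Christoffel symbol `Γᵏᵢⱼ` of the metric tensor `G`. -/
noncomputable def christoffel (G : E3 → Matrix (Fin 3) (Fin 3) ℝ) (k i j : Fin 3) (x : E3) : ℝ :=
  (1 / 2) * ∑ l, (G x)⁻¹ k l *
    (pd i (fun y => G y l j) x + pd j (fun y => G y l i) x - pd l (fun y => G y i j) x)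

/-- The Ricci tensor
`Rᵢⱼ = ∂ₖ Γᵏᵢⱼ - ∂ⱼ Γᵏᵢₖ + Γᵏₖₗ Γˡᵢⱼ - Γᵏⱼₗ Γˡᵢₖ` (sums over `k`, `l`). -/
noncomputable def ricci (G : E3 → Matrix (Fin 3) (Fin 3) ℝ) (i j : Fin 3) (x : E3) : ℝ :=
  ∑ k, (pd k (christoffel G k i j) x - pd j (christoffel G k i k) x +
    ∑ l, (christoffel G k k l x * christoffel G l i j x -
      christoffel G k j l x * christoffel G l i k x))

/-- The scalar curvature. -/
noncomputable def scalarCurvature (G : E3 → Matrix (Fin 3) (Fin 3) ℝ) (x : E3) : ℝ :=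
  ∑ i, ∑ j, (G x)⁻¹ i j * ricci G i j x

/-- The length of the gradient of `u` for the metric tensor `G`. -/
noncomputable def gradNorm (G : E3 → Matrix (Fin 3) (Fin 3) ℝ) (u : E3 → ℝ) (x : E3) : ℝ :=
  Real.sqrt (∑ i, ∑ j, (G x)⁻¹ i j * pd i u x * pd j u x)

/-- The `i`-th component of the unit normal field `∇u / |∇u|` of the level sets of `u`. -/
noncomputable def unitNormal (G : E3 → Matrix (Fin 3) (Fin 3) ℝ) (u : E3 → ℝ) (i : Fin 3)
    (x : E3) : ℝ :=
  (∑ j, (G x)⁻¹ i j * pd j u x) / gradNorm G u x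

/-- The mean curvature `div (∇u / |∇u|)` of the level set of `u` through `x`, where
`div V = (det G)^(-1/2) ∂ᵢ((det G)^(1/2) Vⁱ)`. -/
noncomputable def levelMeanCurvature (G : E3 → Matrix (Fin 3) (Fin 3) ℝ) (u : E3 → ℝ) (x : E3) :
    ℝ :=
  (Real.sqrt (G x).det)⁻¹ *
    ∑ i, pd i (fun y => Real.sqrt (G y).det * unitNormal G u i y) x

/-- The subset `S` of the open set `U` is, near each of its points, an embedded surface (a regular
level set of a smooth function) with vanishing mean curvature for the metric tensor `G`. -/
def IsMinimalSurfaceIn (G : E3 → Matrix (Fin 3) (Fin 3) ℝ) (U S : Set E3) : Prop :=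
  ∀ p ∈ S, ∃ V : Set E3, IsOpen V ∧ p ∈ V ∧ V ⊆ U ∧
    ∃ u : E3 → ℝ, ContDiffOn ℝ ∞ u V ∧ (∀ x ∈ V, fderiv ℝ u x ≠ 0) ∧
      S ∩ V = {x ∈ V | u x = 0} ∧ ∀ x ∈ S ∩ V, levelMeanCurvature G u x = 0

/-! ### Rotationally symmetric metrics on the three-sphere -/

open Classical in
/-- The metric tensor `dr² + f(r)² g_{S²}` written in the Cartesian coordinates `x = r θ`. -/
noncomputable def polarMetric (f : ℝ → ℝ) (x : E3) : Matrix (Fin 3) (Fin 3) ℝ :=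
  if x = 0 then 1 else
    Matrix.of fun i j =>
      (f ‖x‖ / ‖x‖) ^ 2 * (if i = j then 1 else 0) +
        (1 - (f ‖x‖ / ‖x‖) ^ 2) * (x i / ‖x‖) * (x j / ‖x‖)

/-- `ds² + f(s)² g_{S²}`, `0 ≤ s ≤ L`, is a smooth rotationally symmetric Riemannian metric on the
three-sphere. The sphere is covered by the two charts `x = s θ` and `x = (L - s) θ` around the poles
`s = 0` and `s = L`, both with image the open ball of radius `L`. -/
structure IsRotSymSphere (L : ℝ) (f : ℝ → ℝ) : Prop where
  length_pos : 0 < L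
  smooth : ContDiffOn ℝ ∞ f (Icc 0 L)
  pos : ∀ s ∈ Ioo 0 L, 0 < f s
  zero_left : f 0 = 0
  zero_right : f L = 0
  deriv_left : derivWithin f (Icc 0 L) 0 = 1
  deriv_right : derivWithin f (Icc 0 L) L = -1
  metric_smooth_left : ∀ i j, ContDiffOn ℝ ∞ (fun x => polarMetric f x i j) (Metric.ball 0 L)
  metric_smooth_right : ∀ i j,
    ContDiffOn ℝ ∞ (fun x => polarMetric (fun r => f (L - r)) x i j) (Metric.ball 0 L)

/-- Nonnegative scalar curvature, checked in the two charts. -/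
def NonnegScalarCurvature (L : ℝ) (f : ℝ → ℝ) : Prop :=
  ∀ x ∈ Metric.ball (0 : E3) L,
    0 ≤ scalarCurvature (polarMetric f) x ∧ 0 ≤ scalarCurvature (polarMetric fun r => f (L - r)) x

/-- The part of `S` in the domain of the chart around the pole `s = 0`, seen in that chart. -/
def leftChartImage (L : ℝ) (f : ℝ → ℝ) (S : Set (WarpedSpace 0 L f)) : Set E3 :=
  {x | ∃ q : WarpedCoord 0 L f, SeparationQuotient.mk q ∈ S ∧ q.s < L ∧ x = q.s • (q.θ : E3)}

/-- The part of `S` in the domain of the chart around the pole `s = L`, seen in that chart. -/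
def rightChartImage (L : ℝ) (f : ℝ → ℝ) (S : Set (WarpedSpace 0 L f)) : Set E3 :=
  {x | ∃ q : WarpedCoord 0 L f,
    SeparationQuotient.mk q ∈ S ∧ 0 < q.s ∧ x = (L - q.s) • (q.θ : E3)}

/-- Closed (compact, without boundary) embedded minimal surfaces in the three-sphere with metric
`ds² + f(s)² g_{S²}`. -/
structure IsClosedMinimalSurface (L : ℝ) (f : ℝ → ℝ) (S : Set (WarpedSpace 0 L f)) : Prop where
  nonempty : S.Nonempty
  compact : IsCompact S
  minimal_left : IsMinimalSurfaceIn (polarMetric f) (Metric.ball 0 L) (leftChartImage L f S)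
  minimal_right : IsMinimalSurfaceIn (polarMetric fun r => f (L - r)) (Metric.ball 0 L)
    (rightChartImage L f S)

/-- The area of a surface: its two-dimensional Hausdorff measure for the Riemannian distance. The
factor `π / 4` is the area of a Euclidean disc of diameter `1`, since Mathlib's Hausdorff measure
gives weight `(diam)²` to a set. -/
noncomputable def surfaceArea {L : ℝ} {f : ℝ → ℝ} (S : Set (WarpedSpace 0 L f)) : ℝ≥0∞ :=
  ENNReal.ofReal (Real.pi / 4) * Measure.hausdorffMeasure 2 S

/-- `MinA`: the infimum of the areas of closed embedded minimal surfaces. -/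
noncomputable def minArea (L : ℝ) (f : ℝ → ℝ) : ℝ≥0∞ :=
  ⨅ (S : Set (WarpedSpace 0 L f)) (_ : IsClosedMinimalSurface L f S), surfaceArea S

/-! ### The limit space -/

/-- Extension of a function on `[0, L]` by zero. -/
noncomputable def extendByZero (L : ℝ) (f : ℝ → ℝ) : ℝ → ℝ := (Icc 0 L).indicator f

/-- `a_∞ = sup {s ∈ [0, D] : g = 0 on [0, s]}`. -/
noncomputable def leftEnd (D : ℝ) (g : ℝ → ℝ) : ℝ :=
  sSup {s ∈ Icc 0 D | ∀ t ∈ Icc 0 s, g t = 0}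

/-- `b_∞ = inf {s ∈ [0, D] : g = 0 on [s, D]}`. -/
noncomputable def rightEnd (D : ℝ) (g : ℝ → ℝ) : ℝ :=
  sInf {s ∈ Icc 0 D | ∀ t ∈ Icc s D, g t = 0}

/-! ### Lower bounds for the length of a curve -/

/-! The limit of the warping functions is continuous, being a uniform limit of continuous functions,
and the volume has density `f(s)²` in `s`. Hence almost every point has `s₀` in the open interval
and `f s₀ ≠ 0` (`ae_warpedVolume`). At such a point continuity alone forces Euclidean tangent cones
(`tangentConesAre_warpedPoint`).

Put `F = |f s₀|` and fix `λ > 1`. On a strip `|s - s₀| < δ` the ratio of `|f|` to `F` lies between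
`1/λ` and `λ`, so the metric is close to the cylinder metric `ds² + F² g_{S²}`. The chart `(s, θ) ↦
(s - s₀) θ₀ + F Pθ`, with `P` the projection orthogonal to `θ₀`, flattens this cylinder near `(s₀,
θ₀)`. It is compared with the distance in both directions: • It is the restriction of an affine map
of `ℝ × E3` whose linear part stretches warped speed by at most `λ`. It is therefore `λ`-Lipschitz
for nearby points, since short curves cannot leave the strip (`norm_coordChart_sub_le`). • Its
inverse carries a straight segment to a curve at most `λ²` times as long (`warpedDist_chartInv_le`).
After division by `r n`, the distortion on the ball of radius `R` is at most `(λ² - 1) · 2R`, and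
`λ` can be chosen as close to `1` as desired. -/

theorem WarpedCurve.enorm_apply_sub_le {a b : ℝ} {f : ℝ → ℝ} (c : WarpedCurve a b)
    (ℓ : ℝ × E3 →L[ℝ] ℝ) {K t : ℝ} (ht : t ∈ Icc 0 c.T)
    (hℓ : ∀ τ ∈ Icc 0 t, ∀ x u, |ℓ (x, u)| ≤ K * Real.sqrt (x ^ 2 + f (c.s τ) ^ 2 * ‖u‖ ^ 2)) :
    ‖ℓ (c.s t, c.θ t) - ℓ (c.s 0, c.θ 0)‖ₑ ≤ ENNReal.ofReal K * c.length f := by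
  obtain ⟨K₁, h₁⟩ := c.s_lipschitz
  obtain ⟨K₂, h₂⟩ := c.θ_lipschitz
  have hsub : Icc 0 t ⊆ Icc 0 c.T := Icc_subset_Icc_right ht.2
  have h₁' := h₁.mono hsub
  have h₂' := h₂.mono hsub
  set g : ℝ → ℝ := fun τ => ℓ (c.s τ, c.θ τ) with hg
  have hgL : LipschitzOnWith (‖ℓ‖₊ * max K₁ K₂) g (Icc 0 t) :=
    ℓ.lipschitz.comp_lipschitzOnWith (h₁'.prodMk h₂')
  -- Lipschitz functions are absolutely continuous, so the increment of `g` is the integral of its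
  -- derivative, which is almost everywhere `ℓ` of the velocity.
  have hac : AbsolutelyContinuousOnInterval g 0 t := by
    apply LipschitzOnWith.absolutelyContinuousOnInterval (K := ‖ℓ‖₊ * max K₁ K₂)
    rwa [uIcc_of_le ht.1]
  have hint := hac.integral_deriv_eq_sub
  have hbound : ∀ᵐ τ ∂(volume.restrict (Ioc 0 t)), ‖deriv g τ‖ₑ ≤ ENNReal.ofReal K *
      ENNReal.ofReal (Real.sqrt ((deriv c.s τ) ^ 2 + (f (c.s τ)) ^ 2 * ‖deriv c.θ τ‖ ^ 2)) := by
    -- The endpoint is discarded because `deriv` is two-sided, while differentiability is only known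
    -- within `Icc 0 t`.
    have hne : ∀ᵐ τ ∂(volume : Measure ℝ), τ ≠ t := by simp [ae_iff]
    filter_upwards [ae_restrict_of_ae h₁'.ae_differentiableWithinAt_of_mem_real,
      ae_restrict_of_ae h₂'.ae_differentiableWithinAt_of_mem_real,
      ae_restrict_of_ae hne, ae_restrict_mem measurableSet_Ioc] with τ hs hθ hτt hτ
    have hmem : τ ∈ Icc 0 t := Ioc_subset_Icc_self hτ
    have hnhds : Icc 0 t ∈ 𝓝 τ := Icc_mem_nhds hτ.1 (lt_of_le_of_ne hτ.2 hτt)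
    have hs' := ((hs hmem).differentiableAt hnhds).hasDerivAt
    have hθ' := ((hθ hmem).differentiableAt hnhds).hasDerivAt
    have hd : deriv g τ = ℓ (deriv c.s τ, deriv c.θ τ) :=
      (ℓ.hasFDerivAt.comp_hasDerivAt τ (hs'.prodMk hθ')).deriv
    rw [hd, ← ENNReal.ofReal_mul' (Real.sqrt_nonneg _), ← ofReal_norm, Real.norm_eq_abs]
    exact ENNReal.ofReal_le_ofReal (hℓ τ hmem _ _)
  calc ‖g t - g 0‖ₑ = ‖∫ τ in Ioc 0 t, deriv g τ‖ₑ := by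
        rw [← hint, intervalIntegral.integral_of_le ht.1]
    _ ≤ ∫⁻ τ in Ioc 0 t, ‖deriv g τ‖ₑ := enorm_integral_le_lintegral_enorm _
    _ ≤ ∫⁻ τ in Ioc 0 t, ENNReal.ofReal K *
      ENNReal.ofReal (Real.sqrt ((deriv c.s τ) ^ 2 + (f (c.s τ)) ^ 2 * ‖deriv c.θ τ‖ ^ 2)) :=
        lintegral_mono_ae hbound
    _ = ENNReal.ofReal K * ∫⁻ τ in Ioc 0 t,
      ENNReal.ofReal (Real.sqrt ((deriv c.s τ) ^ 2 + (f (c.s τ)) ^ 2 * ‖deriv c.θ τ‖ ^ 2)) :=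
        lintegral_const_mul' _ _ ENNReal.ofReal_ne_top
    _ ≤ ENNReal.ofReal K * c.length f := by
        gcongr
        exact lintegral_mono_set (Ioc_subset_Icc_self.trans hsub)

/-- Reduces to functionals by pairing `M` with the unit vector in the direction of the increment. -/
theorem WarpedCurve.enorm_map_sub_le {a b : ℝ} {f : ℝ → ℝ} (c : WarpedCurve a b)
    {E : Type*} [NormedAddCommGroup E] [InnerProductSpace ℝ E]
    (M : ℝ × E3 →L[ℝ] E) {K t : ℝ} (ht : t ∈ Icc 0 c.T)
    (hM : ∀ τ ∈ Icc 0 t, ∀ x u, ‖M (x, u)‖ ≤ K * Real.sqrt (x ^ 2 + f (c.s τ) ^ 2 * ‖u‖ ^ 2)) :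
    ‖M (c.s t, c.θ t) - M (c.s 0, c.θ 0)‖ₑ ≤ ENNReal.ofReal K * c.length f := by
  set e : E := M (c.s t, c.θ t) - M (c.s 0, c.θ 0) with he
  rcases eq_or_ne e 0 with h0 | h0
  · simp [h0]
  have hpos : 0 < ‖e‖ := norm_pos_iff.2 h0
  have key := c.enorm_apply_sub_le (f := f) ((innerSL ℝ (‖e‖⁻¹ • e)).comp M) (K := K) ht
    (by
      intro τ hτ x u
      refine (abs_real_inner_le_norm _ _).trans ?_
      rw [norm_smul, norm_inv, norm_norm, inv_mul_cancel₀ hpos.ne', one_mul]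
      exact hM τ hτ x u)
  have : ((innerSL ℝ (‖e‖⁻¹ • e)).comp M) (c.s t, c.θ t) -
      ((innerSL ℝ (‖e‖⁻¹ • e)).comp M) (c.s 0, c.θ 0) = ‖e‖ := by
    rw [← map_sub, ContinuousLinearMap.comp_apply, map_sub, ← he, innerSL_apply_apply,
      real_inner_smul_left, real_inner_self_eq_norm_sq]
    field_simp
  rwa [this, enorm_norm] at key

/-- Warped speed dominates `|s'|`. Having this at intermediate times `t` is what confines short
curves to a strip. -/
theorem WarpedCurve.enorm_s_sub_le {a b : ℝ} (f : ℝ → ℝ) (c : WarpedCurve a b) {t : ℝ}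
    (ht : t ∈ Icc 0 c.T) : ‖c.s t - c.s 0‖ₑ ≤ c.length f := by
  have h := c.enorm_map_sub_le (f := f) (ContinuousLinearMap.fst ℝ ℝ E3) (K := 1) ht
    (by
      intro τ _ x u
      rw [one_mul]
      refine Real.le_sqrt_of_sq_le ?_
      simp only [ContinuousLinearMap.coe_fst', Real.norm_eq_abs, sq_abs]
      nlinarith [sq_nonneg (f (c.s τ) * ‖u‖)])
  simpa using h

/-- A curve shorter than `δ / 2` starting within `δ / 2` of `s₀` stays in the strip `|s - s₀| < δ`,
so a bound on `M` over the strip suffices. Longer curves do not affect the infimum. -/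
theorem enorm_map_sub_le_warpedDist {a b : ℝ} {f : ℝ → ℝ} {s₀ δ K : ℝ}
    {E : Type*} [NormedAddCommGroup E] [InnerProductSpace ℝ E] (M : ℝ × E3 →L[ℝ] E)
    (hM : ∀ s ∈ Icc a b, |s - s₀| < δ → ∀ x u,
      ‖M (x, u)‖ ≤ K * Real.sqrt (x ^ 2 + f s ^ 2 * ‖u‖ ^ 2))
    (p q : WarpedCoord a b f) (hp : |p.s - s₀| ≤ δ / 2)
    (hpq : warpedDist p q < ENNReal.ofReal (δ / 2)) :
    ‖M (q.s, q.θ) - M (p.s, p.θ)‖ₑ ≤ ENNReal.ofReal K * warpedDist p q := by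
  have hc : ∀ c : WarpedCurve a b, c.Joins p q → c.length f < ENNReal.ofReal (δ / 2) →
      ‖M (q.s, q.θ) - M (p.s, p.θ)‖ₑ ≤ ENNReal.ofReal K * c.length f := by
    intro c ⟨h1, h2, h3, h4⟩ hlen
    rw [← h1, ← h2, ← h3, ← h4]
    refine c.enorm_map_sub_le M ⟨c.T_nonneg, le_rfl⟩ fun τ hτ => hM _ (c.s_mem τ hτ) ?_
    have h5 := (c.enorm_s_sub_le f hτ).trans_lt hlen
    rw [← ofReal_norm, Real.norm_eq_abs, h1] at h5
    have h6 := (ENNReal.ofReal_lt_ofReal_iff_of_nonneg (abs_nonneg _)).1 h5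
    have := abs_sub_le (c.s τ) p.s s₀
    linarith
  have hlt : ∀ r : ℝ≥0∞, warpedDist p q < r →
      ‖M (q.s, q.θ) - M (p.s, p.θ)‖ₑ ≤ ENNReal.ofReal K * r := by
    intro r hr
    obtain ⟨c, hc1⟩ := iInf_lt_iff.1 (lt_min hr hpq : warpedDist p q < _)
    obtain ⟨hc2, hc3⟩ := iInf_lt_iff.1 hc1
    refine (hc c hc2 (hc3.trans_le (min_le_right _ _))).trans ?_
    gcongr
    exact (hc3.trans_le (min_le_left _ _)).le
  -- The infimum is reached by letting `r` decrease to the distance.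
  have : (𝓝[>] (warpedDist p q)).NeBot := nhdsGT_neBot_of_exists_gt ⟨_, hpq⟩
  refine ge_of_tendsto (f := fun r : ℝ≥0∞ => ENNReal.ofReal K * r)
    (x := 𝓝[>] (warpedDist p q)) ?_ (eventually_nhdsWithin_of_forall hlt)
  exact (ENNReal.continuous_const_mul ENNReal.ofReal_ne_top).continuousWithinAt.tendsto

/-! ### A chart of the warped product with values in Euclidean space -/

/-- The orthogonal projection along `θ₀`. -/
noncomputable def tangentProj (θ₀ : E3) : E3 →L[ℝ] E3 :=
  ContinuousLinearMap.id ℝ E3 - (innerSL ℝ θ₀).smulRight θ₀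

theorem tangentProj_apply (θ₀ u : E3) : tangentProj θ₀ u = u - inner ℝ θ₀ u • θ₀ := by
  simp [tangentProj]

theorem inner_tangentProj {θ₀ : E3} (h₀ : ‖θ₀‖ = 1) (u : E3) :
    inner ℝ θ₀ (tangentProj θ₀ u) = 0 := by
  rw [tangentProj_apply, inner_sub_right, real_inner_smul_right, real_inner_self_eq_norm_sq, h₀]
  ring

theorem norm_smul_add_sq {θ₀ u : E3} (h₀ : ‖θ₀‖ = 1) (hu : inner ℝ θ₀ u = 0) (x : ℝ) :
    ‖u + x • θ₀‖ ^ 2 = x ^ 2 + ‖u‖ ^ 2 := by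
  rw [norm_add_sq_real, real_inner_smul_right, real_inner_comm, hu, norm_smul, h₀,
    Real.norm_eq_abs, mul_one, sq_abs]
  ring

theorem norm_sq_eq_inner_sq_add {θ₀ : E3} (h₀ : ‖θ₀‖ = 1) (u : E3) :
    ‖u‖ ^ 2 = inner ℝ θ₀ u ^ 2 + ‖tangentProj θ₀ u‖ ^ 2 := by
  rw [← norm_smul_add_sq h₀ (inner_tangentProj h₀ u), tangentProj_apply, sub_add_cancel]

theorem norm_tangentProj_le {θ₀ : E3} (h₀ : ‖θ₀‖ = 1) (u : E3) : ‖tangentProj θ₀ u‖ ≤ ‖u‖ := by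
  refine (sq_le_sq₀ (norm_nonneg _) (norm_nonneg _)).1 ?_
  rw [norm_sq_eq_inner_sq_add h₀ u]
  nlinarith [sq_nonneg (inner ℝ θ₀ u : ℝ)]

theorem tangentProj_of_inner_eq_zero {θ₀ u : E3} (hu : inner ℝ θ₀ u = 0) :
    tangentProj θ₀ u = u := by
  rw [tangentProj_apply, hu, zero_smul, sub_zero]

theorem tangentProj_self {θ₀ : E3} (h₀ : ‖θ₀‖ = 1) : tangentProj θ₀ θ₀ = 0 := by
  rw [tangentProj_apply, real_inner_self_eq_norm_sq, h₀]
  simp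

/-- The linear map `(s, u) ↦ s θ₀ + F Pu`, where `P` is the orthogonal projection along `θ₀`. -/
noncomputable def warpChart (F : ℝ) (θ₀ : E3) : ℝ × E3 →L[ℝ] E3 :=
  (ContinuousLinearMap.fst ℝ ℝ E3).smulRight θ₀ +
    F • (tangentProj θ₀).comp (ContinuousLinearMap.snd ℝ ℝ E3)

theorem warpChart_apply (F : ℝ) (θ₀ : E3) (x : ℝ) (u : E3) :
    warpChart F θ₀ (x, u) = F • tangentProj θ₀ u + x • θ₀ := by
  simp [warpChart, add_comm]

theorem norm_warpChart_sq {θ₀ : E3} (h₀ : ‖θ₀‖ = 1) (F x : ℝ) (u : E3) :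
    ‖warpChart F θ₀ (x, u)‖ ^ 2 = x ^ 2 + F ^ 2 * ‖tangentProj θ₀ u‖ ^ 2 := by
  rw [warpChart_apply, norm_smul_add_sq h₀
    (by rw [real_inner_smul_right, inner_tangentProj h₀, mul_zero]),
    norm_smul, mul_pow, Real.norm_eq_abs, sq_abs]

/-- The two components of the chart are orthogonal and the projection does not increase norms; `1 ≤
lam` absorbs the `s` component. -/
theorem norm_warpChart_le {θ₀ : E3} (h₀ : ‖θ₀‖ = 1) {F g lam : ℝ} (hF : 0 ≤ F) (hlam : 1 ≤ lam)
    (hg : F ≤ lam * |g|) (x : ℝ) (u : E3) :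
    ‖warpChart F θ₀ (x, u)‖ ≤ lam * Real.sqrt (x ^ 2 + g ^ 2 * ‖u‖ ^ 2) := by
  have h1 : lam * Real.sqrt (x ^ 2 + g ^ 2 * ‖u‖ ^ 2) =
      Real.sqrt (lam ^ 2 * (x ^ 2 + g ^ 2 * ‖u‖ ^ 2)) := by
    rw [Real.sqrt_mul (sq_nonneg _), Real.sqrt_sq (by linarith)]
  rw [h1]
  refine Real.le_sqrt_of_sq_le ?_
  rw [norm_warpChart_sq h₀]
  have h2 : F ^ 2 ≤ lam ^ 2 * g ^ 2 := by
    rw [← sq_abs g, ← mul_pow]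
    exact pow_le_pow_left₀ hF hg 2
  have h3 : ‖tangentProj θ₀ u‖ ^ 2 ≤ ‖u‖ ^ 2 :=
    pow_le_pow_left₀ (norm_nonneg _) (norm_tangentProj_le h₀ u) 2
  have h4 : x ^ 2 ≤ lam ^ 2 * x ^ 2 := le_mul_of_one_le_left (sq_nonneg _) (one_le_pow₀ hlam)
  have h5 := mul_le_mul h2 h3 (sq_nonneg _) (by positivity)
  linarith

/-- The inverse of the projection of the half sphere around `θ₀` to the equatorial disc. -/
noncomputable def sphereLift (θ₀ u : E3) : E3 := u + Real.sqrt (1 - ‖u‖ ^ 2) • θ₀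

theorem norm_sphereLift {θ₀ u : E3} (h₀ : ‖θ₀‖ = 1) (hu : inner ℝ θ₀ u = 0) (h1 : ‖u‖ ≤ 1) :
    ‖sphereLift θ₀ u‖ = 1 := by
  have h2 : ‖u‖ ^ 2 ≤ 1 := pow_le_one₀ (norm_nonneg _) h1
  have h3 : ‖sphereLift θ₀ u‖ ^ 2 = 1 := by
    rw [sphereLift, norm_smul_add_sq h₀ hu, Real.sq_sqrt (by linarith)]
    ring
  exact (pow_eq_one_iff_of_nonneg (norm_nonneg _) two_ne_zero).1 h3

theorem sphereLift_tangentProj {θ₀ θ : E3} (h₀ : ‖θ₀‖ = 1) (hθ : ‖θ‖ = 1)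
    (h : 0 ≤ (inner ℝ θ₀ θ : ℝ)) : sphereLift θ₀ (tangentProj θ₀ θ) = θ := by
  have h1 := norm_sq_eq_inner_sq_add h₀ θ
  rw [hθ] at h1
  have h2 : 1 - ‖tangentProj θ₀ θ‖ ^ 2 = (inner ℝ θ₀ θ : ℝ) ^ 2 := by linarith
  rw [sphereLift, h2, Real.sqrt_sq h, tangentProj_apply, sub_add_cancel]

theorem tangentProj_sphereLift {θ₀ u : E3} (h₀ : ‖θ₀‖ = 1) (hu : inner ℝ θ₀ u = 0) :
    tangentProj θ₀ (sphereLift θ₀ u) = u := by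
  rw [sphereLift, map_add, map_smul, tangentProj_self h₀, smul_zero, add_zero,
    tangentProj_of_inner_eq_zero hu]

/-- The hemisphere is nearly flat near its pole: both square roots are at least `1 / 2`, so their
difference is at most the difference of their squares, `(‖v‖ - ‖u‖)(‖v‖ + ‖u‖)` in absolute value.
-/
theorem norm_sphereLift_sub_le {θ₀ u v : E3} (h₀ : ‖θ₀‖ = 1) {ρ : ℝ} (hρ : ρ ≤ 1 / 2)
    (hu : ‖u‖ ≤ ρ) (hv : ‖v‖ ≤ ρ) :
    ‖sphereLift θ₀ u - sphereLift θ₀ v‖ ≤ (1 + 2 * ρ) * ‖u - v‖ := by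
  have hu0 := norm_nonneg u
  have hv0 := norm_nonneg v
  have hsq : ∀ w : E3, ‖w‖ ≤ ρ → 1 / 2 ≤ Real.sqrt (1 - ‖w‖ ^ 2) := fun w hw => by
    refine Real.le_sqrt_of_sq_le ?_
    nlinarith [norm_nonneg w]
  have key : |Real.sqrt (1 - ‖u‖ ^ 2) - Real.sqrt (1 - ‖v‖ ^ 2)| ≤ 2 * ρ * ‖u - v‖ := by
    have e1 := Real.sq_sqrt (show 0 ≤ 1 - ‖u‖ ^ 2 by nlinarith)
    have e2 := Real.sq_sqrt (show 0 ≤ 1 - ‖v‖ ^ 2 by nlinarith)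
    have g1 := hsq u hu
    have g2 := hsq v hv
    set x := Real.sqrt (1 - ‖u‖ ^ 2)
    set y := Real.sqrt (1 - ‖v‖ ^ 2)
    have e3 : (x - y) * (x + y) = (‖v‖ - ‖u‖) * (‖v‖ + ‖u‖) := by linarith
    calc |x - y| ≤ |x - y| * |x + y| := by
          refine le_mul_of_one_le_right (abs_nonneg _) ?_
          rw [abs_of_nonneg (by linarith)]
          linarith
      _ = |‖v‖ - ‖u‖| * (‖v‖ + ‖u‖) := by
          rw [← abs_mul, e3, abs_mul, abs_of_nonneg (add_nonneg hv0 hu0)]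
      _ ≤ ‖u - v‖ * (2 * ρ) := by
          rw [abs_sub_comm]
          exact mul_le_mul (abs_norm_sub_norm_le _ _) (by linarith) (by linarith) (norm_nonneg _)
      _ = 2 * ρ * ‖u - v‖ := mul_comm _ _
  have e : sphereLift θ₀ u - sphereLift θ₀ v =
      (u - v) + (Real.sqrt (1 - ‖u‖ ^ 2) - Real.sqrt (1 - ‖v‖ ^ 2)) • θ₀ := by
    rw [sphereLift, sphereLift, sub_smul]
    abel
  rw [e]
  refine (norm_add_le _ _).trans ?_
  rw [norm_smul, h₀, mul_one, Real.norm_eq_abs]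
  linarith

/-- The inverse of the chart `(s, θ) ↦ (s - s₀) θ₀ + F Pθ`. -/
noncomputable def chartInv (F s₀ : ℝ) (θ₀ z : E3) : ℝ × E3 :=
  (s₀ + inner ℝ θ₀ z, sphereLift θ₀ (F⁻¹ • tangentProj θ₀ z))

theorem inner_smul_tangentProj {θ₀ : E3} (h₀ : ‖θ₀‖ = 1) (c : ℝ) (z : E3) :
    inner ℝ θ₀ (c • tangentProj θ₀ z) = 0 := by
  rw [real_inner_smul_right, inner_tangentProj h₀, mul_zero]

theorem warpChart_chartInv {θ₀ : E3} (h₀ : ‖θ₀‖ = 1) {F : ℝ} (hF : F ≠ 0) (s₀ : ℝ) (z : E3) :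
    warpChart F θ₀ ((chartInv F s₀ θ₀ z).1 - s₀, (chartInv F s₀ θ₀ z).2) = z := by
  rw [warpChart_apply, chartInv, tangentProj_sphereLift h₀ (inner_smul_tangentProj h₀ _ _),
    smul_inv_smul₀ hF, add_sub_cancel_left, tangentProj_apply, sub_add_cancel]

theorem chartInv_warpChart {θ₀ θ : E3} (h₀ : ‖θ₀‖ = 1) (hθ : ‖θ‖ = 1) {F : ℝ} (hF : F ≠ 0)
    (s s₀ : ℝ) (h : 0 ≤ (inner ℝ θ₀ θ : ℝ)) :
    chartInv F s₀ θ₀ (warpChart F θ₀ (s - s₀, θ)) = (s, θ) := by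
  have h1 : inner ℝ θ₀ (warpChart F θ₀ (s - s₀, θ)) = s - s₀ := by
    rw [warpChart_apply, inner_add_right, inner_smul_tangentProj h₀, real_inner_smul_right,
      real_inner_self_eq_norm_sq, h₀]
    ring
  have h2 : F⁻¹ • tangentProj θ₀ (warpChart F θ₀ (s - s₀, θ)) = tangentProj θ₀ θ := by
    rw [warpChart_apply, map_add, map_smul, map_smul, tangentProj_self h₀, smul_zero, add_zero,
      tangentProj_of_inner_eq_zero (inner_tangentProj h₀ _), inv_smul_smul₀ hF]
  rw [chartInv, h1, h2, sphereLift_tangentProj h₀ hθ h, add_sub_cancel]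

theorem norm_chartInv_snd {θ₀ z : E3} (h₀ : ‖θ₀‖ = 1) {F : ℝ} (hF : 0 < F) (hz : ‖z‖ ≤ F)
    (s₀ : ℝ) : ‖(chartInv F s₀ θ₀ z).2‖ = 1 := by
  refine norm_sphereLift h₀ (inner_smul_tangentProj h₀ _ _) ?_
  rw [norm_smul, Real.norm_eq_abs, abs_of_pos (inv_pos.2 hF), inv_mul_le_one₀ hF]
  exact (norm_tangentProj_le h₀ z).trans hz

theorem abs_chartInv_fst_sub_le {θ₀ : E3} (h₀ : ‖θ₀‖ = 1) (F s₀ : ℝ) (z : E3) :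
    |(chartInv F s₀ θ₀ z).1 - s₀| ≤ ‖z‖ := by
  rw [chartInv, add_sub_cancel_left]
  simpa [h₀] using abs_real_inner_le_norm θ₀ z

theorem norm_chartInv_snd_sub_le {θ₀ z w : E3} (h₀ : ‖θ₀‖ = 1) {F ρ : ℝ} (hF : 0 < F)
    (hρ : ρ ≤ 1 / 2) (hz : ‖z‖ ≤ F * ρ) (hw : ‖w‖ ≤ F * ρ) (s₀ : ℝ) :
    ‖(chartInv F s₀ θ₀ z).2 - (chartInv F s₀ θ₀ w).2‖ ≤
      (1 + 2 * ρ) * (F⁻¹ * ‖tangentProj θ₀ (z - w)‖) := by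
  have hn : ∀ v : E3, ‖F⁻¹ • v‖ = F⁻¹ * ‖v‖ := fun v => by
    rw [norm_smul, Real.norm_eq_abs, abs_of_pos (inv_pos.2 hF)]
  have hs : ∀ v : E3, ‖v‖ ≤ F * ρ → ‖F⁻¹ • tangentProj θ₀ v‖ ≤ ρ := fun v hv => by
    rw [hn, inv_mul_le_iff₀ hF]
    exact (norm_tangentProj_le h₀ v).trans hv
  refine (norm_sphereLift_sub_le h₀ hρ (hs z hz) (hs w hw)).trans (le_of_eq ?_)
  rw [← smul_sub, hn, map_sub]

/-! ### The chart is almost isometric near a point where the warping function is nonzero -/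

/-- Lifts the segment from `z` to `w`, which stays in the convex ball of radius `F * ρ`. Its `s`
component is affine; its angular speed is at most `lam * F⁻¹` times the tangential part of `w - z`,
and the factor `|f| ≤ lam * F` turns this into `lam ^ 2`. -/
theorem warpedDist_chartInv_le {a b : ℝ} {f : ℝ → ℝ} {s₀ F ρ lam : ℝ} {θ₀ : E3} (h₀ : ‖θ₀‖ = 1)
    (hF : 0 < F) (hρ : ρ ≤ 1 / 2) (hlam : 1 ≤ lam) (hρlam : 1 + 2 * ρ ≤ lam)
    (hmem : ∀ s, |s - s₀| ≤ F * ρ → s ∈ Icc a b ∧ |f s| ≤ lam * F)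
    (p q : WarpedCoord a b f) {z w : E3} (hz : ‖z‖ ≤ F * ρ) (hw : ‖w‖ ≤ F * ρ)
    (hp : chartInv F s₀ θ₀ z = (p.s, (p.θ : E3))) (hq : chartInv F s₀ θ₀ w = (q.s, (q.θ : E3))) :
    warpedDist p q ≤ ENNReal.ofReal (lam ^ 2 * ‖w - z‖) := by
  set γ : ℝ → E3 := fun t => z + t • (w - z) with hγ
  have hγsub : ∀ t t', γ t - γ t' = (t - t') • (w - z) := fun t t' => by
    simp only [hγ, sub_smul]
    abel
  have hγball : ∀ t ∈ Icc (0 : ℝ) 1, ‖γ t‖ ≤ F * ρ := fun t ht => by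
    have e : γ t = (1 - t) • z + t • w := by
      simp only [hγ, smul_sub, sub_smul, one_smul]
      abel
    rw [e]
    refine (norm_add_le _ _).trans ?_
    rw [norm_smul, norm_smul, Real.norm_eq_abs, Real.norm_eq_abs, abs_of_nonneg ht.1,
      abs_of_nonneg (by linarith [ht.2])]
    nlinarith [ht.1, ht.2]
  have hρ0 : 0 ≤ F * ρ := (norm_nonneg z).trans hz
  have hFρ : F * ρ ≤ F := by nlinarith
  set x : ℝ := inner ℝ θ₀ (w - z) with hx
  set y : ℝ := ‖tangentProj θ₀ (w - z)‖ with hy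
  have hy0 : 0 ≤ y := norm_nonneg _
  have hsdiff : ∀ t t', (chartInv F s₀ θ₀ (γ t)).1 - (chartInv F s₀ θ₀ (γ t')).1 =
      (t - t') * x := fun t t' => by
    simp only [chartInv, add_sub_add_left_eq_sub]
    rw [← inner_sub_right, hγsub, real_inner_smul_right]
  set κ : ℝ := lam * (F⁻¹ * y) with hκ
  have hκ0 : 0 ≤ κ := by positivity
  have hθL : LipschitzOnWith κ.toNNReal (fun t => (chartInv F s₀ θ₀ (γ t)).2) (Icc 0 1) := by
    refine LipschitzOnWith.of_dist_le_mul fun t ht t' ht' => ?_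
    rw [dist_eq_norm, Real.coe_toNNReal _ hκ0, Real.dist_eq]
    refine (norm_chartInv_snd_sub_le h₀ hF hρ (hγball t ht) (hγball t' ht') s₀).trans ?_
    rw [hγsub, map_smul, norm_smul, Real.norm_eq_abs, hκ]
    have : 0 ≤ F⁻¹ * (|t - t'| * y) := by positivity
    calc (1 + 2 * ρ) * (F⁻¹ * (|t - t'| * y)) ≤ lam * (F⁻¹ * (|t - t'| * y)) := by gcongr
      _ = lam * (F⁻¹ * y) * |t - t'| := by ring
  let c : WarpedCurve a b :=
    { T := 1
      s := fun t => (chartInv F s₀ θ₀ (γ t)).1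
      θ := fun t => (chartInv F s₀ θ₀ (γ t)).2
      T_nonneg := zero_le_one
      s_lipschitz := ⟨‖x‖₊, LipschitzOnWith.of_dist_le_mul fun t _ t' _ => by
        rw [Real.dist_eq, hsdiff, abs_mul, Real.dist_eq, coe_nnnorm, Real.norm_eq_abs, mul_comm]⟩
      θ_lipschitz := ⟨_, hθL⟩
      s_mem := fun t ht =>
        (hmem _ ((abs_chartInv_fst_sub_le h₀ F s₀ _).trans (hγball t ht))).1
      θ_mem := fun t ht => by
        rw [mem_sphere_zero_iff_norm]
        exact norm_chartInv_snd h₀ hF ((hγball t ht).trans hFρ) s₀ }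
  have hγ0 : γ 0 = z := by simp [hγ]
  have hγ1 : γ 1 = w := by simp [hγ]
  have hc : c.Joins p q := by
    refine ⟨?_, ?_, ?_, ?_⟩ <;> simp only [c, hγ0, hγ1, hp, hq]
  refine (iInf₂_le c hc).trans ?_
  -- Only interior times: the Lipschitz bound on `Icc 0 1` does not control `deriv` at the
  -- endpoints.
  have hbound : ∀ t ∈ Ioo (0 : ℝ) 1, ENNReal.ofReal (Real.sqrt ((deriv c.s t) ^ 2 +
      (f (c.s t)) ^ 2 * ‖deriv c.θ t‖ ^ 2)) ≤ ENNReal.ofReal (lam ^ 2 * ‖w - z‖) := by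
    intro t ht
    have htI := Ioo_subset_Icc_self ht
    have hds : deriv c.s t = x := by
      have e : c.s = fun τ => (chartInv F s₀ θ₀ (γ 0)).1 + τ * x := by
        funext τ
        have := hsdiff τ 0
        simp only [c]
        linarith
      rw [e]
      simp
    have hdθ : ‖deriv c.θ t‖ ≤ κ := by
      have := norm_deriv_le_of_lipschitzOn (Icc_mem_nhds ht.1 ht.2) hθL
      rwa [Real.coe_toNNReal _ hκ0] at this
    have hft : |f (c.s t)| ≤ lam * F :=
      (hmem _ ((abs_chartInv_fst_sub_le h₀ F s₀ _).trans (hγball t htI))).2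
    refine ENNReal.ofReal_le_ofReal (Real.sqrt_le_iff.2 ⟨by positivity, ?_⟩)
    have e1 : |f (c.s t)| * ‖deriv c.θ t‖ ≤ lam ^ 2 * y := by
      calc |f (c.s t)| * ‖deriv c.θ t‖ ≤ (lam * F) * κ := by gcongr
        _ = lam ^ 2 * y := by
          rw [hκ]
          field_simp
    have e2 : (f (c.s t)) ^ 2 * ‖deriv c.θ t‖ ^ 2 ≤ (lam ^ 2 * y) ^ 2 := by
      rw [← sq_abs (f _), ← mul_pow]
      exact pow_le_pow_left₀ (by positivity) e1 2
    rw [hds, mul_pow, norm_sq_eq_inner_sq_add h₀ (w - z), ← hx, ← hy, mul_add, ← mul_pow _ y]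
    have e3 : x ^ 2 ≤ (lam ^ 2) ^ 2 * x ^ 2 :=
      le_mul_of_one_le_left (sq_nonneg _) (one_le_pow₀ (one_le_pow₀ hlam))
    linarith
  calc c.length f = ∫⁻ t in Ioo (0 : ℝ) 1, ENNReal.ofReal (Real.sqrt ((deriv c.s t) ^ 2 +
      (f (c.s t)) ^ 2 * ‖deriv c.θ t‖ ^ 2)) := setLIntegral_congr Ioo_ae_eq_Icc.symm
    _ ≤ ∫⁻ _ in Ioo (0 : ℝ) 1, ENNReal.ofReal (lam ^ 2 * ‖w - z‖) :=
        setLIntegral_mono' measurableSet_Ioo hbound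
    _ = ENNReal.ofReal (lam ^ 2 * ‖w - z‖) := by simp

theorem norm_map_sub_le_toReal_warpedDist {a b : ℝ} {f : ℝ → ℝ} {s₀ δ K : ℝ} (hK : 0 ≤ K)
    {E : Type*} [NormedAddCommGroup E] [InnerProductSpace ℝ E] (M : ℝ × E3 →L[ℝ] E)
    (hM : ∀ s ∈ Icc a b, |s - s₀| < δ → ∀ x u,
      ‖M (x, u)‖ ≤ K * Real.sqrt (x ^ 2 + f s ^ 2 * ‖u‖ ^ 2))
    (p q : WarpedCoord a b f) (hp : |p.s - s₀| ≤ δ / 2)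
    (hpq : warpedDist p q < ENNReal.ofReal (δ / 2)) :
    ‖M (q.s, q.θ) - M (p.s, p.θ)‖ ≤ K * (warpedDist p q).toReal := by
  have h := enorm_map_sub_le_warpedDist M hM p q hp hpq
  have h' := ENNReal.toReal_mono
    (ENNReal.mul_ne_top ENNReal.ofReal_ne_top (hpq.trans ENNReal.ofReal_lt_top).ne) h
  rwa [toReal_enorm, ENNReal.toReal_mul, ENNReal.toReal_ofReal hK] at h'

/-- The chart around `(s₀, θ₀)`. -/
noncomputable def coordChart {a b : ℝ} {f : ℝ → ℝ} (F s₀ : ℝ) (θ₀ : E3) (p : WarpedCoord a b f) :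
    E3 :=
  warpChart F θ₀ (p.s - s₀, p.θ)

theorem coordChart_sub {a b : ℝ} {f : ℝ → ℝ} (F s₀ : ℝ) (θ₀ : E3) (p q : WarpedCoord a b f) :
    coordChart F s₀ θ₀ q - coordChart F s₀ θ₀ p =
      warpChart F θ₀ (q.s, q.θ) - warpChart F θ₀ (p.s, p.θ) := by
  rw [coordChart, coordChart, ← map_sub, ← map_sub]
  simp

theorem norm_coordChart_sub_le {a b : ℝ} {f : ℝ → ℝ} {s₀ δ F lam : ℝ} {θ₀ : E3} (h₀ : ‖θ₀‖ = 1)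
    (hF : 0 ≤ F) (hlam : 1 ≤ lam) (hf : ∀ s ∈ Icc a b, |s - s₀| < δ → F ≤ lam * |f s|)
    (p q : WarpedCoord a b f) (hp : |p.s - s₀| ≤ δ / 2)
    (hpq : warpedDist p q < ENNReal.ofReal (δ / 2)) :
    ‖coordChart F s₀ θ₀ q - coordChart F s₀ θ₀ p‖ ≤ lam * (warpedDist p q).toReal := by
  rw [coordChart_sub]
  exact norm_map_sub_le_toReal_warpedDist (by linarith) _
    (fun s hs hsδ x u => norm_warpChart_le h₀ hF hlam (hf s hs hsδ) x u) p q hp hpq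

theorem coordChart_self {a b : ℝ} {f : ℝ → ℝ} {s₀ F : ℝ} {θ₀ : S2} (hs₀ : s₀ ∈ Icc a b) :
    coordChart F s₀ θ₀ (⟨s₀, hs₀, θ₀⟩ : WarpedCoord a b f) = 0 := by
  rw [coordChart, warpChart_apply, tangentProj_self (mem_sphere_zero_iff_norm.1 θ₀.2)]
  simp

theorem abs_s_sub_lt {a b : ℝ} {f : ℝ → ℝ} {d : ℝ} (p q : WarpedCoord a b f)
    (hpq : warpedDist p q < ENNReal.ofReal d) : |q.s - p.s| < d := by
  have hd : 0 < d := ENNReal.ofReal_pos.1 (pos_of_gt hpq)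
  have h := norm_map_sub_le_toReal_warpedDist (f := f) (s₀ := p.s) (δ := 2 * d) zero_le_one
    (ContinuousLinearMap.fst ℝ ℝ E3) (fun s _ _ x u => by
      rw [one_mul]
      refine Real.le_sqrt_of_sq_le ?_
      simp only [ContinuousLinearMap.coe_fst', Real.norm_eq_abs, sq_abs]
      nlinarith [sq_nonneg (f s * ‖u‖)]) p q (by simp [hd.le])
    (by rwa [mul_div_cancel_left₀ _ two_ne_zero])
  have h2 := ENNReal.toReal_lt_of_lt_ofReal hpq
  simp only [ContinuousLinearMap.coe_fst', Real.norm_eq_abs] at h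
  linarith

/-- Places `x` in the hemisphere where `chartInv` inverts the chart. The Lipschitz estimate applied
to `(s, u) ↦ F u` gives `‖x.θ - θ₀‖ ≤ 1 / 2`. -/
theorem inner_nonneg_of_warpedDist_lt {a b : ℝ} {f : ℝ → ℝ} {s₀ δ F lam d : ℝ} {θ₀ : S2}
    (hF : 0 < F) (hlam : 1 ≤ lam) (hf : ∀ s ∈ Icc a b, |s - s₀| < δ → F ≤ lam * |f s|)
    (hs₀ : s₀ ∈ Icc a b) (hdδ : d ≤ δ / 2) (hdF : lam * d ≤ F / 2) (x : WarpedCoord a b f)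
    (hx : warpedDist ⟨s₀, hs₀, θ₀⟩ x < ENNReal.ofReal d) :
    0 ≤ (inner ℝ (θ₀ : E3) x.θ : ℝ) := by
  have hd : 0 < d := ENNReal.ofReal_pos.1 (pos_of_gt hx)
  have h := norm_map_sub_le_toReal_warpedDist (by linarith : 0 ≤ lam)
    (F • ContinuousLinearMap.snd ℝ ℝ E3) (fun s hs hsδ x u => by
      have h1 : ‖(F • ContinuousLinearMap.snd ℝ ℝ E3) (x, u)‖ = F * ‖u‖ := by
        simp [norm_smul, abs_of_pos hF]
      rw [h1]
      have h2 : |f s| * ‖u‖ ≤ Real.sqrt (x ^ 2 + f s ^ 2 * ‖u‖ ^ 2) := by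
        refine Real.le_sqrt_of_sq_le ?_
        rw [mul_pow, sq_abs]
        linarith [sq_nonneg x]
      calc F * ‖u‖ ≤ lam * |f s| * ‖u‖ := by
            gcongr
            exact hf s hs hsδ
        _ = lam * (|f s| * ‖u‖) := mul_assoc _ _ _
        _ ≤ _ := by gcongr) ⟨s₀, hs₀, θ₀⟩ x (by simp; linarith)
    (hx.trans_le (ENNReal.ofReal_le_ofReal hdδ))
  have h2 := ENNReal.toReal_lt_of_lt_ofReal hx
  have h3 : F * ‖(x.θ : E3) - θ₀‖ ≤ F / 2 := by
    have e : (F • ContinuousLinearMap.snd ℝ ℝ E3) (x.s, (x.θ : E3)) -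
        (F • ContinuousLinearMap.snd ℝ ℝ E3) (s₀, (θ₀ : E3)) = F • ((x.θ : E3) - θ₀) := by
      simp [smul_sub]
    rw [e, norm_smul, Real.norm_eq_abs, abs_of_pos hF] at h
    refine h.trans (le_trans ?_ hdF)
    gcongr
  have h4 : ‖(x.θ : E3) - θ₀‖ ≤ 1 / 2 := by
    by_contra! hcon
    nlinarith
  have h5 := norm_sub_sq_real (x.θ : E3) θ₀
  rw [mem_sphere_zero_iff_norm.1 x.θ.2, mem_sphere_zero_iff_norm.1 θ₀.2, real_inner_comm] at h5
  nlinarith [norm_nonneg ((x.θ : E3) - θ₀)]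

/-! ### Tangent cones of warped products with continuous warping function -/

theorem exists_nearly_isometric_bounds {a b : ℝ} {f : ℝ → ℝ} (hf : ContinuousOn f (Icc a b))
    {s₀ : ℝ} (hs₀ : s₀ ∈ Ioo a b) (hne : f s₀ ≠ 0) {lam : ℝ} (hlam : 1 < lam) :
    ∃ δ > 0, ∀ s, |s - s₀| < δ → s ∈ Icc a b ∧ |f s| ≤ lam * |f s₀| ∧ |f s₀| ≤ lam * |f s| := by
  have hF : 0 < |f s₀| := abs_pos.2 hne
  have hmem : Icc a b ∈ 𝓝 s₀ := Icc_mem_nhds hs₀.1 hs₀.2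
  have hcont : ContinuousAt (fun s => |f s|) s₀ := (hf.continuousAt hmem).abs
  have h1 : ∀ᶠ s in 𝓝 s₀, |f s| < lam * |f s₀| :=
    hcont.eventually_lt continuousAt_const (by nlinarith)
  have h2 : ∀ᶠ s in 𝓝 s₀, |f s₀| < lam * |f s| :=
    continuousAt_const.eventually_lt (continuousAt_const.mul hcont) (by nlinarith)
  obtain ⟨δ, hδ, h⟩ := Metric.eventually_nhds_iff.1 (h1.and (h2.and hmem))
  refine ⟨δ, hδ, fun s hs => ?_⟩
  obtain ⟨e1, e2, e3⟩ := h (by rwa [Real.dist_eq])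
  exact ⟨e3, e1.le, e2.le⟩

/-- Two points of a ball of radius `R` are less than `2 * R` apart, so there a multiplicative error
`lam ^ 2` costs less than `ε`. -/
theorem exists_dilatation (R : ℝ) {ε : ℝ} (hε : 0 < ε) :
    ∃ lam : ℝ, 1 < lam ∧ (lam ^ 2 - 1) * (2 * R) < ε := by
  have h : ∀ᶠ x in 𝓝 (1 : ℝ), (x ^ 2 - 1) * (2 * R) < ε := by
    have : ContinuousAt (fun x : ℝ => (x ^ 2 - 1) * (2 * R)) 1 := by fun_prop
    exact this.eventually_lt continuousAt_const (by simpa using hε)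
  obtain ⟨x, hx, hx1⟩ := ((h.filter_mono nhdsWithin_le_nhds).and
    (self_mem_nhdsWithin : Ioi (1 : ℝ) ∈ 𝓝[>] 1)).exists
  exact ⟨x, hx1, hx⟩

theorem tangentConesAre_warpedPoint {a b : ℝ} {f : ℝ → ℝ} (hf : ContinuousOn f (Icc a b))
    {s₀ : ℝ} (hs₀ : s₀ ∈ Ioo a b) (hne : f s₀ ≠ 0) (θ₀ : S2) (hs₀' : s₀ ∈ Icc a b) :
    TangentConesAre (warpedPoint f hs₀' θ₀) (0 : E3) := by
  intro r hr hr0 R hR ε hε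
  have h₀ : ‖(θ₀ : E3)‖ = 1 := mem_sphere_zero_iff_norm.1 θ₀.2
  set F := |f s₀| with hFdef
  have hF : 0 < F := abs_pos.2 hne
  obtain ⟨lam, hlam, hlamε⟩ := exists_dilatation R hε
  obtain ⟨δ, hδ, hnear⟩ := exists_nearly_isometric_bounds hf hs₀ hne hlam
  -- `ρ` is the angular size of the chart: `1 + 2 * ρ` is the distortion of the sphere lift, and `F
  -- * ρ ≤ δ / 2` keeps lifted points in the strip.
  obtain ⟨ρ, hρ0, hρ1, hρ2, hρ3⟩ :
      ∃ ρ : ℝ, 0 < ρ ∧ ρ ≤ 1 / 2 ∧ 1 + 2 * ρ ≤ lam ∧ F * ρ ≤ δ / 2 := by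
    refine ⟨min (min (1 / 2) ((lam - 1) / 2)) (δ / 2 / F), ?_, ?_, ?_, ?_⟩
    · exact lt_min (lt_min (by norm_num) (by linarith)) (by positivity)
    · exact (min_le_left _ _).trans (min_le_left _ _)
    · have := (min_le_left (min (1 / 2) ((lam - 1) / 2)) (δ / 2 / F)).trans (min_le_right _ _)
      linarith
    · have := min_le_right (min (1 / 2) ((lam - 1) / 2)) (δ / 2 / F)
      rwa [mul_comm, ← le_div_iff₀ hF]
  have hlow : ∀ s ∈ Icc a b, |s - s₀| < δ → F ≤ lam * |f s| := fun s _ h => (hnear s h).2.2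
  have hup : ∀ s, |s - s₀| ≤ F * ρ → s ∈ Icc a b ∧ |f s| ≤ lam * F := fun s h =>
    have h' := hnear s (by linarith)
    ⟨h'.1, h'.2.1⟩
  set p₀ : WarpedCoord a b f := ⟨s₀, hs₀', θ₀⟩ with hp₀
  -- With `δ / 4`, two points of the unscaled ball are less than `δ / 2` apart, as the Lipschitz
  -- bound requires; with `F * ρ`, the chart sends the ball into the domain of the inverse estimate.
  have hev : ∀ᶠ n in atTop, lam * (r n * R) < min (δ / 4) (F * ρ) := by
    have : Tendsto (fun n => lam * (r n * R)) atTop (𝓝 (lam * (0 * R))) :=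
      (hr0.mul_const R).const_mul lam
    refine this.eventually_lt_const ?_
    simp only [zero_mul, mul_zero]
    exact lt_min (by linarith) (by positivity)
  filter_upwards [hev] with n hn
  have hrn := hr n
  set d := r n * R with hd
  have hd0 : 0 < d := mul_pos hrn hR
  have hdlam : d ≤ lam * d := le_mul_of_one_le_left hd0.le hlam.le
  have hn1 : lam * d < δ / 4 := hn.trans_le (min_le_left _ _)
  have hn2 : lam * d < F * ρ := hn.trans_le (min_le_right _ _)
  have hball : ∀ x : WarpedSpace a b f,
      ENNReal.ofReal (r n)⁻¹ * edist (warpedPoint f hs₀' θ₀) x < ENNReal.ofReal R ↔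
        warpedDist p₀ x.out < ENNReal.ofReal d := by
    intro x
    have e : edist (warpedPoint f hs₀' θ₀) x = warpedDist p₀ x.out := by
      conv_lhs => rw [← Quotient.out_eq x]
      rfl
    rw [e, hd, ENNReal.ofReal_inv_of_pos hrn, ENNReal.ofReal_mul hrn.le, mul_comm,
      ← div_eq_mul_inv, ENNReal.div_lt_iff (Or.inl (ENNReal.ofReal_pos.2 hrn).ne')
      (Or.inl ENNReal.ofReal_ne_top), mul_comm]
  have hedist : ∀ x y : WarpedSpace a b f, edist x y = warpedDist x.out y.out := by
    intro x y
    conv_lhs => rw [← Quotient.out_eq x, ← Quotient.out_eq y]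
    rfl
  have hlip : ∀ p q : WarpedCoord a b f, |p.s - s₀| ≤ δ / 2 →
      warpedDist p q < ENNReal.ofReal (δ / 2) →
      ‖coordChart F s₀ θ₀ q - coordChart F s₀ θ₀ p‖ ≤ lam * (warpedDist p q).toReal :=
    fun p q => norm_coordChart_sub_le h₀ hF.le hlam.le hlow p q
  -- In the strip the chart is constant on classes of points at distance zero, so the representative
  -- chosen by `out` does not matter.
  have hzero : ∀ p q : WarpedCoord a b f, |p.s - s₀| ≤ δ / 2 → warpedDist p q = 0 →
      coordChart F s₀ θ₀ q = coordChart F s₀ θ₀ p := by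
    intro p q hp hpq
    have := hlip p q hp (by rw [hpq]; exact ENNReal.ofReal_pos.2 (by linarith))
    rw [hpq, ENNReal.toReal_zero, mul_zero] at this
    exact sub_eq_zero.1 (norm_le_zero_iff.1 this)
  have hout : ∀ p : WarpedCoord a b f,
      warpedDist p (SeparationQuotient.mk p : WarpedSpace a b f).out = 0 := by
    intro p
    have h : edist (SeparationQuotient.mk p : WarpedSpace a b f)
        (SeparationQuotient.mk p : WarpedSpace a b f) = 0 := edist_self _
    conv_lhs at h => rw [← Quotient.out_eq (SeparationQuotient.mk p : WarpedSpace a b f)]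
    have h2 : warpedDist (SeparationQuotient.mk p : WarpedSpace a b f).out
      (SeparationQuotient.mk p : WarpedSpace a b f).out = 0 := h
    have h3 : edist (SeparationQuotient.mk p : WarpedSpace a b f)
      (SeparationQuotient.mk (SeparationQuotient.mk p : WarpedSpace a b f).out) = 0 := by
      rw [show SeparationQuotient.mk (SeparationQuotient.mk p : WarpedSpace a b f).out =
        (SeparationQuotient.mk p : WarpedSpace a b f) from Quotient.out_eq _]
      exact edist_self _
    exact h3
  have hsmall : ∀ x : WarpedCoord a b f, warpedDist p₀ x < ENNReal.ofReal d →
      |x.s - s₀| < δ / 4 ∧ ‖coordChart F s₀ θ₀ x‖ ≤ F * ρ ∧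
        chartInv F s₀ θ₀ (coordChart F s₀ θ₀ x) = (x.s, (x.θ : E3)) := by
    intro x hx
    refine ⟨(abs_s_sub_lt p₀ x hx).trans_le (by linarith), ?_, ?_⟩
    · have h1 := hlip p₀ x (by simp [hp₀]; linarith)
        (hx.trans_le (ENNReal.ofReal_le_ofReal (by linarith)))
      rw [hp₀, coordChart_self, sub_zero] at h1
      have h2 := ENNReal.toReal_lt_of_lt_ofReal hx
      refine h1.trans (le_trans ?_ hn2.le)
      gcongr
    · exact chartInv_warpChart h₀ (mem_sphere_zero_iff_norm.1 x.θ.2) hF.ne' _ _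
        (inner_nonneg_of_warpedDist_lt hF hlam.le hlow hs₀' (by linarith)
          (by nlinarith) x hx)
  refine ⟨fun x => (r n)⁻¹ • coordChart F s₀ θ₀ x.out, ?_, ?_, ?_⟩
  · have h1 := hzero p₀ _ (by simp [hp₀]; linarith) (hout p₀)
    rw [hp₀, coordChart_self] at h1
    exact smul_eq_zero_of_right _ h1
  · intro x y hx hy
    rw [hball] at hx hy
    rw [hedist]
    set p := x.out
    set q := y.out
    obtain ⟨hp1, hp2, hp3⟩ := hsmall p hx
    obtain ⟨hq1, hq2, hq3⟩ := hsmall q hy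
    have hpq : warpedDist p q < ENNReal.ofReal (2 * d) := by
      refine (warpedDist_triangle p p₀ q).trans_lt ?_
      rw [two_mul, ENNReal.ofReal_add hd0.le hd0.le]
      exact ENNReal.add_lt_add ((warpedDist_comm_le _ _).trans_lt hx) hy
    have hA := hlip p q (by linarith)
      (hpq.trans_le (ENNReal.ofReal_le_ofReal (by linarith)))
    have hB := warpedDist_chartInv_le h₀ hF hρ1 hlam.le hρ2 hup p q hp2 hq2 hp3 hq3
    have hB' := ENNReal.toReal_mono ENNReal.ofReal_ne_top hB
    rw [ENNReal.toReal_ofReal (by positivity)] at hB'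
    have hC := ENNReal.toReal_lt_of_lt_ofReal hpq
    set e := (warpedDist p q).toReal with he
    have he0 : 0 ≤ e := ENNReal.toReal_nonneg
    rw [dist_comm, dist_eq_norm, ← smul_sub, norm_smul, Real.norm_eq_abs,
      abs_of_pos (inv_pos.2 hrn), ← mul_sub, abs_mul, abs_of_pos (inv_pos.2 hrn),
      inv_mul_lt_iff₀ hrn]
    set N := ‖coordChart F s₀ θ₀ q - coordChart F s₀ θ₀ p‖ with hN
    have hk : 0 ≤ lam ^ 2 - 1 := by nlinarith
    have h3 : (lam ^ 2 - 1) * e ≤ (lam ^ 2 - 1) * (2 * d) := by gcongr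
    have h4 : (lam ^ 2 - 1) * (2 * d) < r n * ε := by
      calc (lam ^ 2 - 1) * (2 * d) = r n * ((lam ^ 2 - 1) * (2 * R)) := by rw [hd]; ring
        _ < r n * ε := by gcongr
    -- From `N ≤ lam * e` and `e ≤ lam ^ 2 * N`, whichever of `N`, `e` is larger, they differ by at
    -- most `(lam ^ 2 - 1) * e`.
    rw [abs_lt]
    constructor
    · rcases le_total N e with h | h
      · nlinarith
      · nlinarith
    · nlinarith
  · intro z hz
    rw [dist_zero_left] at hz
    have hz1 : ‖r n • z‖ < d := by
      rw [norm_smul, Real.norm_eq_abs, abs_of_pos hrn, hd]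
      gcongr
      linarith
    have hz2 : ‖r n • z‖ ≤ F * ρ := by linarith
    have hs := abs_chartInv_fst_sub_le h₀ F s₀ (r n • z)
    set q : WarpedCoord a b f := ⟨(chartInv F s₀ θ₀ (r n • z)).1, (hup _ (hs.trans hz2)).1,
      ⟨(chartInv F s₀ θ₀ (r n • z)).2, mem_sphere_zero_iff_norm.2
        (norm_chartInv_snd h₀ hF (hz2.trans (by nlinarith)) s₀)⟩⟩ with hq
    have hqz : coordChart F s₀ θ₀ q = r n • z := warpChart_chartInv h₀ hF.ne' s₀ _
    have hp₀z : chartInv F s₀ θ₀ 0 = (p₀.s, (p₀.θ : E3)) := by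
      have h := chartInv_warpChart h₀ h₀ hF.ne' s₀ s₀ real_inner_self_nonneg
      have h' := coordChart_self (f := f) (F := F) (θ₀ := θ₀) hs₀'
      rw [coordChart] at h'
      rwa [h'] at h
    have hdist := warpedDist_chartInv_le h₀ hF hρ1 hlam.le hρ2 hup p₀ q (z := 0) (w := r n • z)
      (by simp; positivity) hz2 hp₀z rfl
    rw [sub_zero] at hdist
    have hlt : warpedDist p₀ q < ENNReal.ofReal d := by
      refine hdist.trans_lt ((ENNReal.ofReal_lt_ofReal_iff hd0).2 ?_)
      rw [norm_smul, Real.norm_eq_abs, abs_of_pos hrn, hd]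
      -- Since `‖z‖ < R - ε`, the excess `(lam ^ 2 - 1) * ‖z‖` is below `ε`. Hence the exact
      -- preimage `q` of `r n • z` lies in the ball.
      have : lam ^ 2 * ‖z‖ < R := by nlinarith [norm_nonneg z]
      calc lam ^ 2 * (r n * ‖z‖) = r n * (lam ^ 2 * ‖z‖) := by ring
        _ < r n * R := by gcongr
    refine ⟨SeparationQuotient.mk q, ?_, ?_⟩
    · rw [hball]
      refine (warpedDist_triangle p₀ q _).trans_lt ?_
      rwa [hout, add_zero]
    · beta_reduce
      rw [hzero q _ (by linarith) (hout q), hqz, inv_smul_smul₀ hrn.ne', dist_self]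
      exact hε

/-! ### The uniform limit of the warping functions -/

/-- There is no jump, because `f` vanishes at both poles. -/
theorem IsRotSymSphere.continuous_extendByZero {L : ℝ} {f : ℝ → ℝ} (h : IsRotSymSphere L f) :
    Continuous (extendByZero L f) := by
  refine continuous_indicator ?_ ?_
  · intro s hs
    rw [frontier_Icc h.length_pos.le] at hs
    rcases hs with rfl | rfl
    exacts [h.zero_left, h.zero_right]
  · rw [isClosed_Icc.closure_eq]
    exact h.smooth.continuousOn

theorem Icc_leftEnd_rightEnd_subset {D : ℝ} {g : ℝ → ℝ} (h : leftEnd D g < rightEnd D g) :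
    Icc (leftEnd D g) (rightEnd D g) ⊆ Icc 0 D := by
  have hl : 0 ≤ leftEnd D g := Real.sSup_nonneg fun s hs => hs.1.1
  refine Icc_subset_Icc hl ?_
  rcases {s ∈ Icc 0 D | ∀ t ∈ Icc s D, g t = 0}.eq_empty_or_nonempty with he | ⟨s, hs⟩
  -- Here `rightEnd` takes the default value `sInf ∅ = 0`, which contradicts `0 ≤ leftEnd D g <
  -- rightEnd D g`.
  · rw [rightEnd, he, Real.sInf_empty] at h
    linarith
  · exact (csInf_le ⟨0, fun t ht => ht.1.1⟩ hs).trans hs.1.2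

/-- The density `f²` kills the zero set of `f`, and the two endpoints are Lebesgue-null. If `b ≤ a`
the measure is zero, so continuity is only asked for when `a < b`. -/
theorem ae_warpedVolume {a b : ℝ} {f : ℝ → ℝ} (hf : a < b → ContinuousOn f (Icc a b)) :
    ∀ᵐ x ∂(warpedVolume a b f), x.1 ∈ Ioo a b ∧ f x.1 ≠ 0 := by
  refine Measure.quasiMeasurePreserving_fst.ae (p := fun s => s ∈ Ioo a b ∧ f s ≠ 0) ?_
  rcases le_or_gt b a with hab | hab
  · have : (volume.restrict (Icc a b) : Measure ℝ) = 0 := by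
      rw [Measure.restrict_eq_zero, Real.volume_Icc, ENNReal.ofReal_eq_zero]
      linarith
    simp [this]
  have hm : AEMeasurable (fun s => ENNReal.ofReal (f s ^ 2)) (volume.restrict (Icc a b)) :=
    (((hf hab).pow 2).aemeasurable measurableSet_Icc).ennreal_ofReal
  rw [ae_withDensity_iff' hm, ← restrict_Ioo_eq_restrict_Icc]
  filter_upwards [ae_restrict_mem measurableSet_Ioo] with s hs h
  refine ⟨hs, fun h0 => h ?_⟩
  simp [h0]

theorem theorem4p6 (D A : ℝ) (hA : 0 < A) (L : ℕ → ℝ) (f : ℕ → ℝ → ℝ)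
    (hM : ∀ j, IsRotSymSphere (L j) (f j))
    (hdiam : ∀ j, Metric.ediam (univ : Set (WarpedSpace 0 (L j) (f j))) ≤ ENNReal.ofReal D)
    (hscal : ∀ j, NonnegScalarCurvature (L j) (f j))
    (hminA : ∀ j, ENNReal.ofReal A ≤ minArea (L j) (f j))
    (φ : ℕ → ℕ) (hφ : StrictMono φ) (finf : ℝ → ℝ)
    (hlim : TendstoUniformlyOn (fun i => extendByZero (L (φ i)) (f (φ i))) finf atTop (Icc 0 D)) :
    ∀ᵐ x ∂(warpedVolume (leftEnd D finf) (rightEnd D finf) finf),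
      ∀ hx : x.1 ∈ Icc (leftEnd D finf) (rightEnd D finf),
        TangentConesAre (warpedPoint finf hx x.2) (0 : EuclideanSpace ℝ (Fin 3)) := by
  have hcont : ContinuousOn finf (Icc 0 D) :=
    hlim.continuousOn (Frequently.of_forall fun i =>
      (hM (φ i)).continuous_extendByZero.continuousOn)
  filter_upwards [ae_warpedVolume fun h => hcont.mono (Icc_leftEnd_rightEnd_subset h)]
    with x hx hx'
  exact tangentConesAre_warpedPoint
    (hcont.mono (Icc_leftEnd_rightEnd_subset (hx.1.1.trans hx.1.2))) hx.1 hx.2 x.2 hx'
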